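/- Let $\mathbb{D}=\{z\in\mathbb{C}:|z|<1\}$ and let $f=H+|z|^2G+|z|^4K$ on $\mathbb{D}$, where $H,G,K:\mathbb{D}\to\mathbb{C}$ are complex-valued harmonic functions (so $f$ is triharmonic, i.e. $\Delta^3 f=0$). Put $$B_f:=\sup_{z,w\in\mathbb{D},\,z\neq w}\frac{|f(z)-f(w)|}{\rho(z,w)},\qquad \rho(z,w)=\frac12\log\frac{1+\left|\frac{z-w}{1-\bar z w}\right|}{1-\left|\frac{z-w}{1-\bar z w}\right|},$$ and suppose that $B_f<\infty$. Then $$B_f\ \geq\ \sup_{z\in\mathbb{D}}(1-|z|^2)\,\Big|\,\big|H_z+|z|^2G_z+|z|^4K_z\big|-\big|H_{\bar z}+|z|^2G_{\bar z}+|z|^4K_{\bar z}\big|\,\Big|.$$ If, moreover, $|H|\le M$, $|G|\le M$ and $|K|\le M$ on $\mathbb{D}$ for a constant $M$, then $$B_f\ \leq\ 2M\,\phi_3(y_1),$$ where $\phi_3(y)=\frac{2}{\pi}(1+y^2+y^4)+y(1+y^2-2y^4)$ and $y_1\in(0,1)$, which depends on none of $f,H,G,K,M$, is a point with $\phi_3(y_1)=\sup_{0<y<1}\phi_3(y)$.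 Numerically, $2\phi_3(y_1)\approx 4.037006$, with an error less than $10^{-6}$. -/

import Mathlib

open Complex Set
open scoped ENNReal

/-- The open unit disk `{z : |z| < 1}`. -/
def unitDisk : Set ℂ := {z : ℂ | ‖z‖ < 1}

/-- The Wirtinger derivative `f_z = (f_x - i f_y) / 2`. -/
noncomputable def wirtZ (f : ℂ → ℂ) (z : ℂ) : ℂ :=
  (fderiv ℝ f z 1 - I * fderiv ℝ f z I) / 2

/-- The Wirtinger derivative `f_{\bar z} = (f_x + i f_y) / 2`. -/
noncomputable def wirtZbar (f : ℂ → ℂ) (z : ℂ) : ℂ :=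
  (fderiv ℝ f z 1 + I * fderiv ℝ f z I) / 2

/-- The pseudo-hyperbolic distance `|(z - w) / (1 - \bar z w)|` on the unit disk. -/
noncomputable def pseudoHypDist (z w : ℂ) : ℝ :=
  ‖(z - w) / (1 - (starRingEnd ℂ) z * w)‖

/-- The hyperbolic distance `ρ(z, w)` on the unit disk. -/
noncomputable def hypDist (z w : ℂ) : ℝ :=
  1 / 2 * Real.log ((1 + pseudoHypDist z w) / (1 - pseudoHypDist z w))

/-- The Bloch norm `B_f = sup { |f z - f w| / ρ(z, w) : z, w in the unit disk, z ≠ w }`,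
with values in `[0, ∞]`. -/
noncomputable def blochNorm (f : ℂ → ℂ) : ℝ≥0∞ :=
  ⨆ (z ∈ unitDisk) (w ∈ unitDisk) (_ : z ≠ w), ENNReal.ofReal (‖f z - f w‖ / hypDist z w)

/-- `φ₃(y) = (2/π)(1 + y² + y⁴) + y(1 + y² - 2y⁴)`. -/
noncomputable def phi3 (y : ℝ) : ℝ :=
  2 / Real.pi * (1 + y ^ 2 + y ^ 4) + y * (1 + y ^ 2 - 2 * y ^ 4)

open InnerProductSpace Filter Topology

/-! Both bounds compare `blochNorm f` with the hyperbolically scaled derivative (1 - |z|²)‖L e‖,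
where L is the real derivative of f at z. Following f along geodesics from z bounds the scaled
derivative by the norm (`ofReal_mul_norm_fderiv_le_blochNorm`); integrating along geodesics gives
the converse (`blochNorm_le_ofReal`). For the lower bound, take e tangential: the derivatives of
|z|² and |z|⁴ vanish, and the reverse triangle inequality leaves the difference of Wirtinger moduli.
For the upper bound, Schwarz–Pick for a strip gives the constant 4/π for each of H, G, K, and the
radial terms are bounded by M; the sum is exactly 2M `phi3 ‖z‖`. -/

/-! ### Numerics of `phi3` -/

theorem two_div_pi_bounds : 0.636619772 < 2 / Real.pi ∧ 2 / Real.pi < 0.636619773 := by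
  have h1 := Real.pi_gt_d20
  have h2 := Real.pi_lt_d20
  have hp := Real.pi_pos
  constructor
  · rw [lt_div_iff₀ hp]; linarith
  · rw [div_lt_iff₀ hp]; linarith

theorem phi3_lt_of_mem_Icc {y : ℝ} (hy : y ∈ Icc (0 : ℝ) 1) : phi3 y < 2.0185035 := by
  obtain ⟨hy0, hy1⟩ := hy
  have h := two_div_pi_bounds.2
  have h1 : 2 / Real.pi * (1 + y ^ 2 + y ^ 4) ≤ 0.636619773 * (1 + y ^ 2 + y ^ 4) :=
    mul_le_mul_of_nonneg_right h.le (by positivity)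
  -- Near the maximiser the gap has almost a double root; the cubic is the rounded quotient by that
  -- square.
  have h2 : 0 ≤ (y - 0.8919509) ^ 2 *
      (2 * y ^ 3 + 2.9311 * y ^ 2 + 2.6377 * y + 1.737) := by positivity
  unfold phi3
  nlinarith [mul_nonneg hy0 hy0, pow_nonneg hy0 3, pow_nonneg hy0 4]

theorem lt_phi3 : 2.0185025 < phi3 0.891951 := by
  have h := two_div_pi_bounds.1
  unfold phi3
  norm_num at h ⊢
  linarith

/-- The maximum is taken over the closed interval because it is later applied at y = ‖z‖, which may
be 0. The endpoint values 2/π and 6/π are below 2.0185, so the maximiser is interior. -/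
theorem exists_isMaxOn_phi3 :
    ∃ y₁ ∈ Ioo (0 : ℝ) 1, ∀ y ∈ Icc (0 : ℝ) 1, phi3 y ≤ phi3 y₁ := by
  obtain ⟨y, hy, hmax⟩ := isCompact_Icc.exists_isMaxOn (nonempty_Icc.2 (zero_le_one' ℝ))
    (f := phi3) (by unfold phi3; fun_prop)
  have hlow : phi3 0.891951 ≤ phi3 y := hmax (by norm_num)
  have h0 := lt_phi3
  have hpi := two_div_pi_bounds.2
  refine ⟨y, ⟨hy.1.lt_of_ne ?_, hy.2.lt_of_ne ?_⟩, fun x hx => hmax hx⟩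
  · rintro rfl
    norm_num [phi3] at *
    linarith
  · rintro rfl
    norm_num [phi3] at *
    linarith

/-! ### Disk automorphisms -/

/-- The disk automorphism `ζ ↦ (z + ζ) / (1 + \bar z ζ)`, which maps `0` to `z`. -/
noncomputable def diskAut (z ζ : ℂ) : ℂ := (z + ζ) / (1 + (starRingEnd ℂ) z * ζ)

theorem one_add_conj_mul_ne_zero {z ζ : ℂ} (hz : ‖z‖ < 1) (hζ : ‖ζ‖ < 1) :
    1 + (starRingEnd ℂ) z * ζ ≠ 0 := by
  intro h
  have h1 : ‖(starRingEnd ℂ) z * ζ‖ = 1 := by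
    rw [show (starRingEnd ℂ) z * ζ = -1 by linear_combination h]; simp
  rw [norm_mul, RCLike.norm_conj] at h1
  nlinarith [norm_nonneg z, norm_nonneg ζ]

theorem sq_norm_one_add_conj_mul_sub (z ζ : ℂ) :
    ‖1 + (starRingEnd ℂ) z * ζ‖ ^ 2 - ‖z + ζ‖ ^ 2 = (1 - ‖z‖ ^ 2) * (1 - ‖ζ‖ ^ 2) := by
  simp only [← normSq_eq_norm_sq, normSq_apply, add_re, add_im, mul_re, mul_im, conj_re, conj_im,
    one_re, one_im]
  ring

theorem one_sub_sq_norm_diskAut {z ζ : ℂ} (hz : ‖z‖ < 1) (hζ : ‖ζ‖ < 1) :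
    1 - ‖diskAut z ζ‖ ^ 2 =
      (1 - ‖z‖ ^ 2) * (1 - ‖ζ‖ ^ 2) / ‖1 + (starRingEnd ℂ) z * ζ‖ ^ 2 := by
  have h : ‖1 + (starRingEnd ℂ) z * ζ‖ ≠ 0 := norm_ne_zero_iff.2 (one_add_conj_mul_ne_zero hz hζ)
  rw [← sq_norm_one_add_conj_mul_sub, diskAut, norm_div, div_pow, sub_div,
    div_self (pow_ne_zero 2 h)]

theorem norm_lt_one_of_one_sub_sq_pos {z : ℂ} (h : 0 < 1 - ‖z‖ ^ 2) : ‖z‖ < 1 := by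
  nlinarith [norm_nonneg z]

theorem one_sub_sq_norm_pos {z : ℂ} (h : ‖z‖ < 1) : 0 < 1 - ‖z‖ ^ 2 := by
  nlinarith [norm_nonneg z]

theorem norm_diskAut_lt_one {z ζ : ℂ} (hz : ‖z‖ < 1) (hζ : ‖ζ‖ < 1) : ‖diskAut z ζ‖ < 1 := by
  apply norm_lt_one_of_one_sub_sq_pos
  rw [one_sub_sq_norm_diskAut hz hζ]
  have h := norm_pos_iff.2 (one_add_conj_mul_ne_zero hz hζ)
  have h1 := one_sub_sq_norm_pos hz
  have h2 := one_sub_sq_norm_pos hζ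
  positivity

theorem hasDerivAt_diskAut {z ζ : ℂ} (hz : ‖z‖ < 1) (hζ : ‖ζ‖ < 1) :
    HasDerivAt (diskAut z) ((1 - (‖z‖ : ℂ) ^ 2) / (1 + (starRingEnd ℂ) z * ζ) ^ 2) ζ := by
  have h := one_add_conj_mul_ne_zero hz hζ
  have h1 : HasDerivAt (fun x : ℂ => z + x) 1 ζ := (hasDerivAt_id ζ).const_add z
  have h2 : HasDerivAt (fun x : ℂ => 1 + (starRingEnd ℂ) z * x) ((starRingEnd ℂ) z * 1) ζ :=
    ((hasDerivAt_id ζ).const_mul _).const_add 1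
  refine (h1.div h2 h).congr_deriv ?_
  rw [← conj_mul']
  congr 1
  ring

theorem diskAut_zero (z : ℂ) : diskAut z 0 = z := by simp [diskAut]

/-- The point mapped to `w` by `diskAut z`. -/
noncomputable def diskAutInv (z w : ℂ) : ℂ := (w - z) / (1 - (starRingEnd ℂ) z * w)

theorem norm_diskAutInv (z w : ℂ) : ‖diskAutInv z w‖ = pseudoHypDist z w := by
  rw [diskAutInv, pseudoHypDist, norm_div, norm_div, norm_sub_rev]

theorem diskAutInv_eq (z w : ℂ) : diskAutInv z w = diskAut (-z) w := by
  simp [diskAutInv, diskAut]; ring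

theorem norm_diskAutInv_lt_one {z w : ℂ} (hz : ‖z‖ < 1) (hw : ‖w‖ < 1) :
    ‖diskAutInv z w‖ < 1 := by
  rw [diskAutInv_eq]
  exact norm_diskAut_lt_one (by simpa) hw

theorem diskAut_diskAutInv {z w : ℂ} (hz : ‖z‖ < 1) (hw : ‖w‖ < 1) :
    diskAut z (diskAutInv z w) = w := by
  have h : 1 - (starRingEnd ℂ) z * w ≠ 0 := by
    have := one_add_conj_mul_ne_zero (z := -z) (by simpa) hw
    simpa [sub_eq_add_neg] using this
  have h2 := one_add_conj_mul_ne_zero hz (norm_diskAutInv_lt_one hz hw)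
  rw [diskAut, div_eq_iff h2, diskAutInv]
  rw [mul_comm] at h
  field_simp
  ring

theorem diskAutInv_diskAut {z ζ : ℂ} (hz : ‖z‖ < 1) (hζ : ‖ζ‖ < 1) :
    diskAutInv z (diskAut z ζ) = ζ := by
  have h := one_add_conj_mul_ne_zero hz hζ
  have h2 := one_add_conj_mul_ne_zero (z := -z) (by simpa) (norm_diskAut_lt_one hz hζ)
  rw [map_neg, neg_mul, ← sub_eq_add_neg] at h2
  rw [diskAutInv, div_eq_iff h2, diskAut]
  rw [mul_comm] at h
  field_simp
  ring

/-! ### Schwarz–Pick for a strip -/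

/-- Precomposing with `diskAut z` moves the zero to the origin, where Schwarz's lemma applies. -/
theorem norm_deriv_mul_le_of_mapsTo_disk {g : ℂ → ℂ} {z : ℂ} (hz : ‖z‖ < 1)
    (hg : ∀ ζ : ℂ, ‖ζ‖ < 1 → DifferentiableAt ℂ g ζ) (hmaps : ∀ ζ : ℂ, ‖ζ‖ < 1 → ‖g ζ‖ ≤ 1)
    (h0 : g z = 0) : ‖deriv g z‖ * (1 - ‖z‖ ^ 2) ≤ 1 := by
  have hd : HasDerivAt (g ∘ diskAut z) (deriv g z * (1 - (‖z‖ : ℂ) ^ 2)) 0 := by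
    have h1 := hasDerivAt_diskAut (ζ := 0) hz (by simp)
    have h2 : HasDerivAt g (deriv g z) (diskAut z 0) := by
      rw [diskAut_zero]; exact (hg z hz).hasDerivAt
    simpa using h2.comp 0 h1
  have key := norm_deriv_le_one_of_mapsTo_ball (f := g ∘ diskAut z) (c := 0) (R := 1)
    (fun ζ hζ => by
      have hζ : ‖ζ‖ < 1 := by simpa using hζ
      exact ((hg _ (norm_diskAut_lt_one hz hζ)).comp ζ
        (hasDerivAt_diskAut hz hζ).differentiableAt).differentiableWithinAt)
    (fun ζ hζ => by
      have hζ : ‖ζ‖ < 1 := by simpa using hζ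
      simpa [diskAut_zero, h0] using hmaps _ (norm_diskAut_lt_one hz hζ)) one_pos
  rw [hd.deriv, norm_mul] at key
  have : ‖(1 - (‖z‖ : ℂ) ^ 2)‖ = 1 - ‖z‖ ^ 2 := by
    rw [← ofReal_one, ← ofReal_pow, ← ofReal_sub, norm_real, Real.norm_of_nonneg
      (one_sub_sq_norm_pos hz).le]
  rwa [this] at key

/-- The squares differ by 4 Re p Re q. Hence the Cayley transform at p sends the right half-plane
into the disk. -/
theorem norm_sub_le_norm_add_conj {p q : ℂ} (hp : 0 ≤ p.re) (hq : 0 ≤ q.re) :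
    ‖q - p‖ ≤ ‖q + (starRingEnd ℂ) p‖ := by
  refine le_of_sq_le_sq ?_ (norm_nonneg _)
  simp only [← normSq_eq_norm_sq, normSq_apply, add_re, add_im, sub_re, sub_im, conj_re, conj_im]
  nlinarith [mul_nonneg hp hq]

/-- The Schwarz–Pick inequality for holomorphic maps of the disk into a vertical strip. -/
theorem norm_deriv_mul_le_of_abs_re_lt {F : ℂ → ℂ} {z : ℂ} {M : ℝ} (hM : 0 < M) (hz : ‖z‖ < 1)
    (hF : ∀ ζ : ℂ, ‖ζ‖ < 1 → DifferentiableAt ℂ F ζ)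
    (hre : ∀ ζ : ℂ, ‖ζ‖ < 1 → |(F ζ).re| < M) :
    ‖deriv F z‖ * (1 - ‖z‖ ^ 2) ≤ 4 / Real.pi * M := by
  -- With this scale, exp(iaF) has argument in (-π/2, π/2), so the strip goes to the right
  -- half-plane.
  set a : ℝ := Real.pi / (2 * M) with ha
  have hpi := Real.pi_pos
  have hapos : 0 < a := by positivity
  set E : ℂ → ℂ := fun ζ => cexp (I * a * F ζ) with hE
  have hEre : ∀ ζ : ℂ, ‖ζ‖ < 1 → 0 < (E ζ).re := by
    intro ζ hζ
    have h := abs_lt.1 (hre ζ hζ)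
    have haM : a * M = Real.pi / 2 := by rw [ha]; field_simp
    rw [hE, exp_re]
    refine mul_pos (Real.exp_pos _) (Real.cos_pos_of_mem_Ioo ⟨?_, ?_⟩)
    · simp [mul_assoc]; nlinarith
    · simp [mul_assoc]; nlinarith
  set p := E z with hp
  have hppos : 0 < p.re := hEre z hz
  have hden : ∀ ζ : ℂ, ‖ζ‖ < 1 → E ζ + (starRingEnd ℂ) p ≠ 0 := by
    intro ζ hζ h
    have := congrArg re h
    simp at this
    linarith [hEre ζ hζ]
  have hEd : ∀ ζ : ℂ, ‖ζ‖ < 1 → HasDerivAt E (E ζ * (I * a * deriv F ζ)) ζ := fun ζ hζ =>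
    ((hF ζ hζ).hasDerivAt.const_mul (I * a)).cexp
  have hgd : ∀ ζ : ℂ, ‖ζ‖ < 1 → HasDerivAt (fun x => (E x - p) / (E x + (starRingEnd ℂ) p)) _ ζ :=
    fun ζ hζ => ((hEd ζ hζ).sub_const p).div ((hEd ζ hζ).add_const _) (hden ζ hζ)
  have key := norm_deriv_mul_le_of_mapsTo_disk (g := fun x => (E x - p) / (E x + (starRingEnd ℂ) p))
    hz (fun ζ hζ => (hgd ζ hζ).differentiableAt) (fun ζ hζ => by
      rw [norm_div]
      exact div_le_one_of_le₀ (norm_sub_le_norm_add_conj hppos.le (hEre ζ hζ).le) (norm_nonneg _))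
    (by simp [hp])
  rw [(hgd z hz).deriv, ← hp, sub_self, zero_mul, sub_zero, add_conj] at key
  have hpn : p.re ≤ ‖p‖ := re_le_norm p
  have hne : p.re ≠ 0 := hppos.ne'
  have hval : ‖p * (I * a * deriv F z) * ((2 * p.re : ℝ) : ℂ) / ((2 * p.re : ℝ) : ℂ) ^ 2‖
      = ‖p‖ * (a * ‖deriv F z‖) / (2 * p.re) := by
    simp only [norm_div, norm_mul, norm_pow, norm_real, norm_I, Real.norm_of_nonneg hapos.le,
      Real.norm_of_nonneg hppos.le, one_mul, Real.norm_ofNat]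
    field_simp
  rw [hval, div_mul_eq_mul_div, div_le_one (by positivity)] at key
  have hs := one_sub_sq_norm_pos hz
  set X := ‖deriv F z‖ * (1 - ‖z‖ ^ 2) with hX
  have hX0 : 0 ≤ X := mul_nonneg (norm_nonneg _) hs.le
  have h2 : p.re * (a * X) ≤ p.re * 2 := calc
    p.re * (a * X) ≤ ‖p‖ * (a * X) := mul_le_mul_of_nonneg_right hpn (by positivity)
    _ = ‖p‖ * (a * ‖deriv F z‖) * (1 - ‖z‖ ^ 2) := by rw [hX]; ring
    _ ≤ p.re * 2 := by linarith
  have h3 : a * X ≤ 2 := le_of_mul_le_mul_left h2 hppos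
  have h4 : X ≤ 2 / a := by rw [le_div_iff₀ hapos]; linarith
  refine h4.trans_eq ?_
  rw [ha]; field_simp; norm_num

/-! ### Gradient bounds for bounded harmonic functions -/

theorem unitDisk_eq_ball : unitDisk = Metric.ball (0 : ℂ) 1 := by
  ext z; simp [unitDisk]

theorem unitDisk_mem_nhds {z : ℂ} (hz : ‖z‖ < 1) : unitDisk ∈ 𝓝 z := by
  rw [unitDisk_eq_ball]
  exact Metric.isOpen_ball.mem_nhds (by simpa)

/-- The sharp gradient estimate for bounded real harmonic functions on the unit disk. -/
theorem abs_fderiv_mul_le_of_harmonicOnNhd {u : ℂ → ℝ} {M : ℝ} (hu : HarmonicOnNhd u unitDisk)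
    (hM : ∀ z ∈ unitDisk, |u z| ≤ M) {z : ℂ} (hz : ‖z‖ < 1) (e : ℂ) :
    |fderiv ℝ u z e| * (1 - ‖z‖ ^ 2) ≤ 4 / Real.pi * M * ‖e‖ := by
  have hpi := Real.pi_pos
  have hM0 : 0 ≤ M := (abs_nonneg _).trans (hM z hz)
  obtain ⟨F, hF, hFu⟩ := HarmonicOnNhd.exists_analyticOnNhd_ball_re_eq (unitDisk_eq_ball ▸ hu)
  have hFd : ∀ ζ : ℂ, ‖ζ‖ < 1 → DifferentiableAt ℂ F ζ := fun ζ hζ =>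
    (hF ζ (by simpa)).differentiableAt
  have hX : ‖deriv F z‖ * (1 - ‖z‖ ^ 2) ≤ 4 / Real.pi * M := by
    have h : ‖deriv F z‖ * (1 - ‖z‖ ^ 2) / (4 / Real.pi) ≤ M := by
      -- The strip lemma needs a strict bound and a positive width, so use every M' > M.
      refine le_of_forall_gt_imp_ge_of_dense fun M' hM' => ?_
      rw [div_le_iff₀' (by positivity)]
      refine norm_deriv_mul_le_of_abs_re_lt (hM0.trans_lt hM') hz hFd fun ζ hζ => ?_
      have h := hFu (show ζ ∈ Metric.ball (0 : ℂ) 1 by simpa)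
      simp only at h
      rw [h]
      exact (hM ζ hζ).trans_lt hM'
    rwa [div_le_iff₀' (by positivity)] at h
  have hd : HasFDerivAt u (reCLM.comp ((deriv F z) • (1 : ℂ →L[ℝ] ℂ))) z := by
    have h1 := reCLM.hasFDerivAt.comp z (hFd z hz).hasDerivAt.complexToReal_fderiv
    refine h1.congr_of_eventuallyEq ?_
    filter_upwards [unitDisk_mem_nhds hz] with x hx
    exact (hFu (unitDisk_eq_ball ▸ hx)).symm
  have he : |fderiv ℝ u z e| ≤ ‖deriv F z‖ * ‖e‖ := by
    rw [hd.fderiv, ← norm_mul]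
    simpa using abs_re_le_norm (deriv F z * e)
  have hs := one_sub_sq_norm_pos hz
  calc |fderiv ℝ u z e| * (1 - ‖z‖ ^ 2) ≤ ‖deriv F z‖ * ‖e‖ * (1 - ‖z‖ ^ 2) := by gcongr
    _ = ‖deriv F z‖ * (1 - ‖z‖ ^ 2) * ‖e‖ := by ring
    _ ≤ _ := by gcongr

/-- Colonna's estimate for bounded complex-valued harmonic functions on the unit disk. -/
theorem norm_fderiv_mul_le_of_harmonicOnNhd {H : ℂ → ℂ} {M : ℝ} (hH : HarmonicOnNhd H unitDisk)
    (hM : ∀ z ∈ unitDisk, ‖H z‖ ≤ M) {z : ℂ} (hz : ‖z‖ < 1) (e : ℂ) :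
    ‖fderiv ℝ H z e‖ * (1 - ‖z‖ ^ 2) ≤ 4 / Real.pi * M * ‖e‖ := by
  set v := fderiv ℝ H z e with hv
  -- Rotate so that the derivative in direction e is real and nonnegative; the real case for Re(cH)
  -- then loses nothing.
  obtain ⟨c, hc, hcv⟩ : ∃ c : ℂ, ‖c‖ = 1 ∧ c * v = ‖v‖ := by
    by_cases h : v = 0
    · exact ⟨1, by simp, by simp [h]⟩
    · have h' : ‖v‖ ≠ 0 := norm_ne_zero_iff.2 h
      refine ⟨(starRingEnd ℂ) v / ‖v‖, by simp [h'], ?_⟩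
      rw [div_mul_eq_mul_div, conj_mul', sq, mul_div_assoc, div_self (by exact_mod_cast h'),
        mul_one]
  set l : ℂ →L[ℝ] ℝ := reCLM.comp (c • (1 : ℂ →L[ℝ] ℂ)) with hl
  have hlv : ∀ w, l w = (c * w).re := fun w => by simp [hl]
  have key := abs_fderiv_mul_le_of_harmonicOnNhd (hH.comp_CLM l) (M := M) (fun w hw => by
    rw [Function.comp_apply, hlv]
    refine (abs_re_le_norm _).trans ?_
    rw [norm_mul, hc, one_mul]
    exact hM w hw) hz e
  have hd : DifferentiableAt ℝ H z := (hH z hz).1.differentiableAt (by norm_num)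
  rwa [(l.hasFDerivAt.comp z hd.hasFDerivAt).fderiv, ContinuousLinearMap.comp_apply, ← hv, hlv,
    hcv, ofReal_re, abs_of_nonneg (norm_nonneg _)] at key

/-! ### The derivative of f -/

theorem fderiv_apply_eq_wirtinger (H : ℂ → ℂ) (z e : ℂ) :
    fderiv ℝ H z e = wirtZ H z * e + wirtZbar H z * (starRingEnd ℂ) e := by
  have h : e = e.re • (1 : ℂ) + e.im • I := by simp
  have h2 : (starRingEnd ℂ) e = e.re - e.im * I := by
    apply Complex.ext <;> simp
  conv_lhs => rw [h, map_add, map_smul, map_smul]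
  conv_rhs => rw [h2, ← re_add_im e]
  simp only [wirtZ, wirtZbar, real_smul, add_re, ofReal_re, mul_re, I_re, mul_zero, ofReal_im, I_im,
    mul_one, sub_self, add_zero, add_im, mul_im, zero_add]
  linear_combination (fderiv ℝ H z I * e.im) * I_sq

theorem exists_hasFDerivAt_triharmonic {f H G K : ℂ → ℂ}
    (hH : HarmonicOnNhd H unitDisk) (hG : HarmonicOnNhd G unitDisk) (hK : HarmonicOnNhd K unitDisk)
    (hf : ∀ z ∈ unitDisk, f z = H z + (‖z‖ : ℂ) ^ 2 * G z + (‖z‖ : ℂ) ^ 4 * K z)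
    {z : ℂ} (hz : ‖z‖ < 1) :
    ∃ L : ℂ →L[ℝ] ℂ, HasFDerivAt f L z ∧ ∀ e, L e =
      fderiv ℝ H z e + (‖z‖ : ℂ) ^ 2 * fderiv ℝ G z e + (‖z‖ : ℂ) ^ 4 * fderiv ℝ K z e +
        2 * (inner ℝ z e : ℝ) * (G z + 2 * (‖z‖ : ℂ) ^ 2 * K z) := by
  have hd : ∀ {U : ℂ → ℂ}, HarmonicOnNhd U unitDisk → HasFDerivAt U (fderiv ℝ U z) z :=
    fun hU => ((hU z hz).1.differentiableAt (by norm_num)).hasFDerivAt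
  have hN : HasFDerivAt (fun x : ℂ => (‖x‖ : ℂ) ^ 2) (ofRealCLM.comp (2 • innerSL ℝ z)) z := by
    have := ofRealCLM.hasFDerivAt.comp z (hasStrictFDerivAt_norm_sq z).hasFDerivAt
    refine this.congr_of_eventuallyEq (Eventually.of_forall fun x => ?_)
    simp
  refine ⟨_, (((hd hH).add (hN.mul (hd hG))).add
    ((hN.mul hN).mul (hd hK))).congr_of_eventuallyEq ?_, fun e => ?_⟩
  · filter_upwards [unitDisk_mem_nhds hz] with x hx
    simp only [hf x hx, Pi.add_apply, Pi.mul_apply]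
    ring
  · simp
    ring

/-- A tangential direction, which removes the G and K terms carrying no derivative. -/
theorem exists_unit_inner_eq_zero (z : ℂ) : ∃ e : ℂ, ‖e‖ = 1 ∧ inner ℝ z e = 0 := by
  by_cases h : z = 0
  · exact ⟨1, by simp, by simp [h]⟩
  · have h' : ‖z‖ ≠ 0 := norm_ne_zero_iff.2 h
    refine ⟨I * z / ‖z‖, by simp [h'], ?_⟩
    rw [Complex.inner, div_eq_mul_inv, ← ofReal_inv,
      show I * z * ((‖z‖⁻¹ : ℝ) : ℂ) * (starRingEnd ℂ) z = ((‖z‖⁻¹ * ‖z‖ ^ 2 : ℝ) : ℂ) * I by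
        push_cast; rw [← mul_conj']; ring]
    rw [re_ofReal_mul, I_re, mul_zero]

/-! ### Bloch norm versus scaled derivative -/

theorem hasDerivAt_half_log {t : ℝ} (ht : |t| < 1) :
    HasDerivAt (fun t : ℝ => 1 / 2 * Real.log ((1 + t) / (1 - t))) (1 / (1 - t ^ 2)) t := by
  obtain ⟨h1, h2⟩ := abs_lt.1 ht
  have h3 : 1 + t ≠ 0 := by linarith
  have h4 : 1 - t ≠ 0 := by linarith
  have h5 : 1 - t ^ 2 ≠ 0 := by
    rw [show 1 - t ^ 2 = (1 + t) * (1 - t) by ring]; exact mul_ne_zero h3 h4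
  refine (((((hasDerivAt_id t).const_add 1).div ((hasDerivAt_id t).const_sub 1) h4).log
    (div_ne_zero h3 h4)).const_mul (1 / 2)).congr_deriv ?_
  simp only [id, Pi.div_apply]
  field_simp
  ring

theorem hypDist_diskAut {z ζ : ℂ} (hz : ‖z‖ < 1) (hζ : ‖ζ‖ < 1) :
    hypDist z (diskAut z ζ) = 1 / 2 * Real.log ((1 + ‖ζ‖) / (1 - ‖ζ‖)) := by
  rw [hypDist, ← norm_diskAutInv, diskAutInv_diskAut hz hζ]

theorem half_log_nonneg {t : ℝ} (h0 : 0 ≤ t) (h1 : t < 1) :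
    0 ≤ 1 / 2 * Real.log ((1 + t) / (1 - t)) := by
  have : 1 ≤ (1 + t) / (1 - t) := by rw [le_div_iff₀ (by linarith)]; linarith
  have := Real.log_nonneg this
  positivity

theorem half_log_pos {t : ℝ} (h0 : 0 < t) (h1 : t < 1) :
    0 < 1 / 2 * Real.log ((1 + t) / (1 - t)) := by
  have : 1 < (1 + t) / (1 - t) := by rw [lt_div_iff₀ (by linarith)]; linarith
  have := Real.log_pos this
  positivity

theorem hypDist_nonneg {z w : ℂ} (hz : ‖z‖ < 1) (hw : ‖w‖ < 1) : 0 ≤ hypDist z w := by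
  have h := norm_diskAutInv_lt_one hz hw
  rw [norm_diskAutInv] at h
  exact half_log_nonneg (norm_nonneg _) h

theorem hasDerivAt_diskAut_ray {z a : ℂ} {t : ℝ} (hz : ‖z‖ < 1) (ha : ‖(t : ℂ) * a‖ < 1) :
    HasDerivAt (fun s : ℝ => diskAut z (s * a))
      ((1 - (‖z‖ : ℂ) ^ 2) / (1 + (starRingEnd ℂ) z * (t * a)) ^ 2 * a) t := by
  have h1 : HasDerivAt (fun s : ℝ => (s : ℂ) * a) a t := by
    simpa using (ofRealCLM.hasDerivAt (x := t)).mul_const a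
  exact (hasDerivAt_diskAut hz ha).comp t h1

/-- The Bloch norm dominates every hyperbolically scaled directional derivative. -/
theorem ofReal_mul_norm_fderiv_le_blochNorm {f : ℂ → ℂ} {L : ℂ →L[ℝ] ℂ} {z e : ℂ} (hz : ‖z‖ < 1)
    (hL : HasFDerivAt f L z) (he : ‖e‖ = 1) :
    ENNReal.ofReal ((1 - ‖z‖ ^ 2) * ‖L e‖) ≤ blochNorm f := by
  by_cases htop : blochNorm f = ∞
  · simp [htop]
  rw [ENNReal.ofReal_le_iff_le_toReal htop]
  set C := (blochNorm f).toReal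
  have hs := one_sub_sq_norm_pos hz
  have hγ := hasDerivAt_diskAut_ray (z := z) (a := e) (t := 0) hz (by simp)
  have hL' : HasFDerivAt f L (diskAut z (((0 : ℝ) : ℂ) * e)) := by simpa [diskAut_zero] using hL
  have hfγ := (hL'.comp_hasDerivAt (0 : ℝ) hγ).tendsto_slope_zero_right.norm
  have hlog := ((hasDerivAt_half_log (t := 0) (by simp)).const_mul C).tendsto_slope_zero_right
  -- Difference quotients along the geodesic from z in direction e; the distance has slope 1 at 0.
  have hlim := le_of_tendsto_of_tendsto hfγ hlog ?_
  · have hv : (1 - (‖z‖ : ℂ) ^ 2) / (1 + (starRingEnd ℂ) z * (((0 : ℝ) : ℂ) * e)) ^ 2 * e =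
        (1 - ‖z‖ ^ 2) • e := by simp
    rw [hv, map_smul, norm_smul, Real.norm_of_nonneg hs.le] at hlim
    simpa using hlim
  · filter_upwards [Ioo_mem_nhdsGT one_pos] with t ht
    have htn : ‖(t : ℂ) * e‖ = t := by simp [he, abs_of_pos ht.1]
    have ht1 : ‖(t : ℂ) * e‖ < 1 := htn.trans_lt ht.2
    have hw := norm_diskAut_lt_one hz ht1
    have hne : z ≠ diskAut z (t * e) := by
      intro h
      have h' := congrArg (diskAutInv z) h
      rw [diskAutInv_diskAut hz ht1] at h'
      have h'' := congrArg norm h'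
      rw [htn] at h''
      simp [diskAutInv] at h''
      exact ht.1.ne h''
    have hle : ENNReal.ofReal (‖f z - f (diskAut z (t * e))‖ / hypDist z (diskAut z (t * e))) ≤
        blochNorm f :=
      le_iSup₂_of_le z hz (le_iSup₂_of_le _ hw (le_iSup_of_le hne le_rfl))
    rw [ENNReal.ofReal_le_iff_le_toReal htop, hypDist_diskAut hz ht1, htn,
      div_le_iff₀ (half_log_pos ht.1 ht.2)] at hle
    simp only [zero_add, Function.comp_apply, ofReal_zero, zero_mul, diskAut_zero, norm_smul,
      smul_eq_mul, add_zero, sub_zero, div_one, Real.log_one, mul_zero, norm_inv,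
      Real.norm_of_nonneg ht.1.le]
    rw [norm_sub_rev]
    exact mul_le_mul_of_nonneg_left hle (inv_nonneg.2 ht.1.le)

/-- Mean value inequality along the geodesic t ↦ `diskAut z (t * a)` from z to w, with P times
hyperbolic arc length as majorant. -/
theorem norm_sub_le_mul_hypDist {f : ℂ → ℂ} {P : ℝ}
    (hf : ∀ z : ℂ, ‖z‖ < 1 → ∃ L : ℂ →L[ℝ] ℂ, HasFDerivAt f L z ∧
      ∀ e, ‖L e‖ * (1 - ‖z‖ ^ 2) ≤ P * ‖e‖) {z w : ℂ} (hz : ‖z‖ < 1) (hw : ‖w‖ < 1) :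
    ‖f z - f w‖ ≤ P * hypDist z w := by
  choose! L hL hLP using hf
  set a := diskAutInv z w
  have ha : ‖a‖ < 1 := norm_diskAutInv_lt_one hz hw
  have hta : ∀ t ∈ Icc (0 : ℝ) 1, ‖(t : ℂ) * a‖ = t * ‖a‖ := fun t ht => by
    simp [abs_of_nonneg ht.1]
  have hta1 : ∀ t ∈ Icc (0 : ℝ) 1, t * ‖a‖ < 1 := fun t ht => by
    nlinarith [ht.1, ht.2, norm_nonneg a]
  have hta' : ∀ t ∈ Icc (0 : ℝ) 1, ‖(t : ℂ) * a‖ < 1 := fun t ht => by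
    rw [hta t ht]; exact hta1 t ht
  have hg : ∀ t ∈ Icc (0 : ℝ) 1, HasDerivAt (fun s : ℝ => f (diskAut z (s * a)) - f z)
      (L (diskAut z (t * a))
        ((1 - (‖z‖ : ℂ) ^ 2) / (1 + (starRingEnd ℂ) z * (t * a)) ^ 2 * a)) t := fun t ht =>
    ((hL _ (norm_diskAut_lt_one hz (hta' t ht))).comp_hasDerivAt t
      (hasDerivAt_diskAut_ray hz (hta' t ht))).sub_const _
  have hB : ∀ t ∈ Icc (0 : ℝ) 1, HasDerivAt
      (fun s : ℝ => P * (1 / 2 * Real.log ((1 + s * ‖a‖) / (1 - s * ‖a‖))))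
      (P * (1 / (1 - (t * ‖a‖) ^ 2) * ‖a‖)) t := fun t ht => by
    have h1 : HasDerivAt (fun s : ℝ => s * ‖a‖) ‖a‖ t := by
      simpa using (hasDerivAt_id t).mul_const ‖a‖
    have h2 : |t * ‖a‖| < 1 := by
      rw [abs_of_nonneg (mul_nonneg ht.1 (norm_nonneg a))]; exact hta1 t ht
    exact ((hasDerivAt_half_log h2).comp t h1).const_mul P
  have key := image_norm_le_of_norm_deriv_right_le_deriv_boundary'
    (fun t ht => (hg t ht).continuousAt.continuousWithinAt)
    (fun t ht => (hg t (Ico_subset_Icc_self ht)).hasDerivWithinAt)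
    (B := fun s : ℝ => P * (1 / 2 * Real.log ((1 + s * ‖a‖) / (1 - s * ‖a‖))))
    (by simp [diskAut_zero])
    (fun t ht => (hB t ht).continuousAt.continuousWithinAt)
    (fun t ht => (hB t (Ico_subset_Icc_self ht)).hasDerivWithinAt)
    (fun t ht => ?_) (right_mem_Icc.2 zero_le_one)
  · simp only [ofReal_one, one_mul] at key
    rw [diskAut_diskAutInv hz hw, norm_diskAutInv, norm_sub_rev] at key
    exact key
  · have ht := Ico_subset_Icc_self ht
    have h1 := hta' t ht
    have hd := norm_pos_iff.2 (one_add_conj_mul_ne_zero hz h1)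
    have hs := one_sub_sq_norm_pos hz
    have hs' := one_sub_sq_norm_pos h1
    have hb := hLP _ (norm_diskAut_lt_one hz h1)
      ((1 - (‖z‖ : ℂ) ^ 2) / (1 + (starRingEnd ℂ) z * (t * a)) ^ 2 * a)
    have hn : ‖(1 - (‖z‖ : ℂ) ^ 2)‖ = 1 - ‖z‖ ^ 2 := by
      rw [← ofReal_one, ← ofReal_pow, ← ofReal_sub, norm_real, Real.norm_of_nonneg hs.le]
    -- The factors from the automorphism cancel (conformal invariance), leaving the density 1/(1 -
    -- |ta|²).
    rw [one_sub_sq_norm_diskAut hz h1, ← le_div_iff₀ (by positivity)] at hb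
    refine hb.trans_eq ?_
    rw [← hta t ht, norm_mul, norm_div, norm_pow, hn]
    generalize ‖1 + (starRingEnd ℂ) z * (t * a)‖ = d at hd
    field_simp

theorem blochNorm_le_ofReal {f : ℂ → ℂ} {P : ℝ} (hP : 0 ≤ P)
    (hf : ∀ z : ℂ, ‖z‖ < 1 → ∃ L : ℂ →L[ℝ] ℂ, HasFDerivAt f L z ∧
      ∀ e, ‖L e‖ * (1 - ‖z‖ ^ 2) ≤ P * ‖e‖) : blochNorm f ≤ ENNReal.ofReal P := by
  refine iSup₂_le fun z hz => iSup₂_le fun w hw => iSup_le fun _ => ENNReal.ofReal_le_ofReal ?_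
  exact div_le_of_le_mul₀ (hypDist_nonneg hz hw) hP (norm_sub_le_mul_hypDist hf hz hw)

/-! ### Assembling the two bounds -/

theorem abs_norm_sub_norm_le_norm_mul_add_mul_conj (A B : ℂ) {e : ℂ} (he : ‖e‖ = 1) :
    |‖A‖ - ‖B‖| ≤ ‖A * e + B * (starRingEnd ℂ) e‖ := by
  have h := abs_norm_sub_norm_le (A * e) (-(B * (starRingEnd ℂ) e))
  simpa [he] using h

/-- The pointwise gradient estimate for a triharmonic function with bounded components. -/
theorem norm_triharmonic_fderiv_mul_le {H G K : ℂ → ℂ} {M : ℝ}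
    (hH : HarmonicOnNhd H unitDisk) (hG : HarmonicOnNhd G unitDisk) (hK : HarmonicOnNhd K unitDisk)
    (hHM : ∀ z ∈ unitDisk, ‖H z‖ ≤ M) (hGM : ∀ z ∈ unitDisk, ‖G z‖ ≤ M)
    (hKM : ∀ z ∈ unitDisk, ‖K z‖ ≤ M) {z : ℂ} (hz : ‖z‖ < 1) (e : ℂ) :
    ‖fderiv ℝ H z e + (‖z‖ : ℂ) ^ 2 * fderiv ℝ G z e + (‖z‖ : ℂ) ^ 4 * fderiv ℝ K z e +
        2 * (inner ℝ z e : ℝ) * (G z + 2 * (‖z‖ : ℂ) ^ 2 * K z)‖ * (1 - ‖z‖ ^ 2) ≤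
      2 * M * phi3 ‖z‖ * ‖e‖ := by
  have h1 := norm_fderiv_mul_le_of_harmonicOnNhd hH hHM hz e
  have h2 := norm_fderiv_mul_le_of_harmonicOnNhd hG hGM hz e
  have h3 := norm_fderiv_mul_le_of_harmonicOnNhd hK hKM hz e
  have hs := one_sub_sq_norm_pos hz
  have hM0 : 0 ≤ M := (norm_nonneg _).trans (hHM z hz)
  have hi : ‖(2 * (inner ℝ z e : ℝ) * (G z + 2 * (‖z‖ : ℂ) ^ 2 * K z) : ℂ)‖ ≤
      2 * (‖z‖ * ‖e‖) * (M + 2 * ‖z‖ ^ 2 * M) := by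
    rw [norm_mul, norm_mul, norm_real, Complex.norm_ofNat]
    gcongr
    · exact norm_inner_le_norm z e
    · refine (norm_add_le _ _).trans (add_le_add (hGM z hz) ?_)
      simp only [norm_mul, norm_pow, norm_real, norm_norm, Complex.norm_ofNat]
      gcongr
      exact hKM z hz
  have hn : ‖fderiv ℝ H z e + (‖z‖ : ℂ) ^ 2 * fderiv ℝ G z e + (‖z‖ : ℂ) ^ 4 * fderiv ℝ K z e +
        2 * (inner ℝ z e : ℝ) * (G z + 2 * (‖z‖ : ℂ) ^ 2 * K z)‖ ≤
      ‖fderiv ℝ H z e‖ + ‖z‖ ^ 2 * ‖fderiv ℝ G z e‖ + ‖z‖ ^ 4 * ‖fderiv ℝ K z e‖ +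
        2 * (‖z‖ * ‖e‖) * (M + 2 * ‖z‖ ^ 2 * M) := by
    refine norm_add₄_le.trans ?_
    simp only [norm_mul, norm_pow, norm_real, norm_norm] at hi ⊢
    gcongr
  refine (mul_le_mul_of_nonneg_right hn hs.le).trans ?_
  have h2' := mul_le_mul_of_nonneg_left h2 (pow_nonneg (norm_nonneg z) 2)
  have h3' := mul_le_mul_of_nonneg_left h3 (pow_nonneg (norm_nonneg z) 4)
  -- This is where `phi3` arises: (1 + 2y²)(1 - y²) = 1 + y² - 2y⁴ with y = ‖z‖.
  have e1 : 2 * M * phi3 ‖z‖ * ‖e‖ = 4 / Real.pi * M * ‖e‖ + ‖z‖ ^ 2 * (4 / Real.pi * M * ‖e‖) +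
      ‖z‖ ^ 4 * (4 / Real.pi * M * ‖e‖) +
      2 * (‖z‖ * ‖e‖) * (M + 2 * ‖z‖ ^ 2 * M) * (1 - ‖z‖ ^ 2) := by
    rw [phi3]; ring
  rw [e1]
  linarith

theorem mainTheorem10 :
    ∃ y₁ ∈ Ioo (0 : ℝ) 1,
      IsLUB (phi3 '' Ioo (0 : ℝ) 1) (phi3 y₁) ∧
      |2 * phi3 y₁ - 4.037006| < 1 / 10 ^ 6 ∧
      ∀ f H G K : ℂ → ℂ,
        InnerProductSpace.HarmonicOnNhd H unitDisk →
        InnerProductSpace.HarmonicOnNhd G unitDisk →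
        InnerProductSpace.HarmonicOnNhd K unitDisk →
        (∀ z ∈ unitDisk, f z = H z + (‖z‖ : ℂ) ^ 2 * G z + (‖z‖ : ℂ) ^ 4 * K z) →
        blochNorm f < ∞ →
        (⨆ z ∈ unitDisk, ENNReal.ofReal ((1 - ‖z‖ ^ 2) *
            |‖wirtZ H z + (‖z‖ : ℂ) ^ 2 * wirtZ G z + (‖z‖ : ℂ) ^ 4 * wirtZ K z‖ -
              ‖wirtZbar H z + (‖z‖ : ℂ) ^ 2 * wirtZbar G z + (‖z‖ : ℂ) ^ 4 * wirtZbar K z‖|))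
          ≤ blochNorm f ∧
        ∀ M : ℝ,
          (∀ z ∈ unitDisk, ‖H z‖ ≤ M) →
          (∀ z ∈ unitDisk, ‖G z‖ ≤ M) →
          (∀ z ∈ unitDisk, ‖K z‖ ≤ M) →
          blochNorm f ≤ ENNReal.ofReal (2 * M * phi3 y₁) := by
  obtain ⟨y₁, hy₁, hmax⟩ := exists_isMaxOn_phi3
  have hlow : 2.0185025 < phi3 y₁ := lt_phi3.trans_le (hmax _ (by norm_num))
  have hup := phi3_lt_of_mem_Icc (Ioo_subset_Icc_self hy₁)
  refine ⟨y₁, hy₁, ⟨?_, fun b hb => hb ⟨y₁, hy₁, rfl⟩⟩, ?_, ?_⟩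
  · rintro _ ⟨y, hy, rfl⟩
    exact hmax y (Ioo_subset_Icc_self hy)
  · rw [abs_lt]
    norm_num at hlow hup ⊢
    constructor <;> linarith
  intro f H G K hH hG hK hf _
  refine ⟨iSup₂_le fun z hz => ?_, fun M hHM hGM hKM => ?_⟩
  · obtain ⟨L, hL, hLe⟩ := exists_hasFDerivAt_triharmonic hH hG hK hf hz
    obtain ⟨e, he, hze⟩ := exists_unit_inner_eq_zero z
    refine le_trans (ENNReal.ofReal_le_ofReal (mul_le_mul_of_nonneg_left ?_
      (one_sub_sq_norm_pos hz).le)) (ofReal_mul_norm_fderiv_le_blochNorm hz hL he)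
    refine (abs_norm_sub_norm_le_norm_mul_add_mul_conj _ _ he).trans_eq (congrArg _ ?_)
    simp only [hLe, hze, fderiv_apply_eq_wirtinger, ofReal_zero]
    ring
  · have hM0 : 0 ≤ M := (norm_nonneg _).trans (hHM 0 (by simp [unitDisk]))
    have hφ : 0 ≤ phi3 y₁ := by linarith
    refine blochNorm_le_ofReal (by positivity) fun z hz => ?_
    obtain ⟨L, hL, hLe⟩ := exists_hasFDerivAt_triharmonic hH hG hK hf hz
    refine ⟨L, hL, fun e => ?_⟩
    rw [hLe]
    refine (norm_triharmonic_fderiv_mul_le hH hG hK hHM hGM hKM hz e).trans ?_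
    have := hmax ‖z‖ ⟨norm_nonneg z, le_of_lt hz⟩
    gcongr
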